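/- Let $d\ge 0$. A \emph{$d$-clutter} (uniform clutter) $C$ is a finite vertex set $V=V(C)$ together with a family of $(d+1)$-element subsets of $V$, called circuits. Its complement $\bar C$ has the same vertex set, and its circuits are the $(d+1)$-subsets of $V$ that are not circuits of $C$. A set $A\subseteq V$ is a \emph{clique} of $C$ if every $(d+1)$-subset of $A$ is a circuit. The \emph{ascent} $C^+$ is the $(d+1)$-clutter on $V$ whose circuits are the cliques of $C$ with $d+2$ vertices. For $F\subseteq V$, $C-F$ is the clutter on $V$ whose circuits are the circuits of $C$ not containing $F$; for $v\in V$, $C-v$ is the clutter on $V\setminus\{v\}$ whose circuits are the circuits of $C$ avoiding $v$. A \emph{maximal subcircuit} of $C$ is a $d$-subset $e$ of $V$ contained in some circuit. It is \emph{free} if it is contained in exactly one circuit, and \emph{simplicial} if its closed neighbourhood $N_C[e]=e\cup\{v\in V: e\cup\{v\}\in C\}$ is a clique. $\mathrm{SMS}(C)$ denotes the set of simplicial maximal subcircuits. $C$ is \emph{chordal} if there are $t\ge 0$ and $e_1,\dots,e_t$ with $C_0=C$, $e_i\in \mathrm{SMS}(C_{i-1})$, $C_i=C_{i-1}-e_i$,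 such that $C_t$ has no circuits. Let $K$ be a field, and for a uniform clutter $D$ let $I(D)\subseteq K[x_v : v\in V(D)]$ be the ideal generated by the monomials $x_F=\prod_{v\in F}x_v$, $F$ a circuit of $D$. A squarefree monomial ideal has \emph{linear quotients} if its minimal squarefree monomial generators can be ordered as $f_1,\dots,f_t$ so that each colon ideal $\langle f_1,\dots,f_{i-1}\rangle:f_i$ is generated by linear forms. A \emph{shelling} of a simplicial complex is an ordering $F_1,\dots,F_t$ of its facets such that for every $i\ge 2$ the complex $\langle F_1,\dots,F_{i-1}\rangle\cap\langle F_i\rangle$ is pure of dimension $\dim F_i-1$. A pure complex $\Delta$ is \emph{extendably shellable} if every shelling of a pure subcomplex of the same dimension (or of the complex without faces) can be continued to a shelling of $\Delta$. Fix a set $X$ (if $X$ is infinite, then up to renaming vertices every finite vertex set occurs in $X$), and consider the following statements. (B) For every uniform clutter $C$ with vertices in $X$: if $I(\bar C)$ has linear quotients, then $C$ is chordal. (C) For every uniform clutter $C$ with vertices in $X$: if $C^+$ has at least one circuit and is chordal, and if $C-F$ and $C-v$ are chordal for all $F\in\mathrm{SMS}(C^+)$ and all $v\in V(C)$, then $\mathrm{SMS}(C)\ne\emptyset$.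 (D') For every uniform clutter $C$ with vertices in $X$ and at least one circuit: if $C^+$ has no circuits and $I(\bar C)$ has linear quotients, then $C$ has a free maximal subcircuit. (E) (Simon's conjecture) For every finite $V\subseteq X$ and every $k\ge 0$, the $k$-skeleton of the simplex on $V$ is extendably shellable. Then (C) and (D') together imply (B), and (B) implies both (D') and (E). -/

import Mathlib

/-- A `d`-dimensional uniform clutter (`d`-clutter) with vertex labels in `α`: a finite vertex set
together with a family of `(d + 1)`-element subsets of it, the circuits. -/
structure UniformClutter (α : Type*) (d : ℕ) where
  verts : Finset α
  circuits : Finset (Finset α)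
  subset_verts : ∀ F ∈ circuits, F ⊆ verts
  card_eq : ∀ F ∈ circuits, F.card = d + 1

namespace UniformClutter

variable {α : Type*} [DecidableEq α] {d : ℕ}

/-- The complement of `C`: same vertex set, and the `(d + 1)`-subsets that are not circuits. -/
def compl (C : UniformClutter α d) : UniformClutter α d where
  verts := C.verts
  circuits := C.verts.powersetCard (d + 1) \ C.circuits
  subset_verts _ hF := (Finset.mem_powersetCard.1 (Finset.mem_sdiff.1 hF).1).1
  card_eq _ hF := (Finset.mem_powersetCard.1 (Finset.mem_sdiff.1 hF).1).2

/-- `A` is a clique of `C`: a set of vertices all of whose `(d + 1)`-subsets are circuits. -/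
def IsClique (C : UniformClutter α d) (A : Finset α) : Prop :=
  A ⊆ C.verts ∧ ∀ F ∈ A.powersetCard (d + 1), F ∈ C.circuits

instance (C : UniformClutter α d) (A : Finset α) : Decidable (C.IsClique A) :=
  inferInstanceAs (Decidable (A ⊆ C.verts ∧ ∀ F ∈ A.powersetCard (d + 1), F ∈ C.circuits))

/-- The ascent `C⁺`: the `(d + 1)`-clutter on the same vertex set whose circuits are the cliques
of `C` with `d + 2` vertices. -/
def ascent (C : UniformClutter α d) : UniformClutter α (d + 1) where
  verts := C.verts
  circuits := (C.verts.powersetCard (d + 2)).filter C.IsClique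
  subset_verts _ hF := (Finset.mem_powersetCard.1 (Finset.mem_filter.1 hF).1).1
  card_eq _ hF := (Finset.mem_powersetCard.1 (Finset.mem_filter.1 hF).1).2

/-- `C - e` for a set `e` of vertices: same vertex set, and the circuits not containing `e`.
If `e` is itself a circuit, this removes just that circuit. -/
def deleteFace (C : UniformClutter α d) (e : Finset α) : UniformClutter α d where
  verts := C.verts
  circuits := C.circuits.filter (fun F => ¬ e ⊆ F)
  subset_verts F hF := C.subset_verts F (Finset.mem_filter.1 hF).1
  card_eq F hF := C.card_eq F (Finset.mem_filter.1 hF).1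

/-- `C - v` for a vertex `v`: the vertex `v` is removed, with all circuits containing it. -/
def deleteVert (C : UniformClutter α d) (v : α) : UniformClutter α d where
  verts := C.verts.erase v
  circuits := C.circuits.filter (fun F => v ∉ F)
  subset_verts F hF := Finset.subset_erase.2
    ⟨C.subset_verts F (Finset.mem_filter.1 hF).1, (Finset.mem_filter.1 hF).2⟩
  card_eq F hF := C.card_eq F (Finset.mem_filter.1 hF).1

/-- The maximal subcircuits: the `d`-subsets of the vertex set contained in some circuit. -/
def MS (C : UniformClutter α d) : Finset (Finset α) :=
  (C.verts.powersetCard d).filter (fun e => ∃ F ∈ C.circuits, e ⊆ F)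

/-- The closed neighbourhood `N[e]`. -/
def closedNhd (C : UniformClutter α d) (e : Finset α) : Finset α :=
  e ∪ C.verts.filter (fun v => insert v e ∈ C.circuits)

/-- The simplicial maximal subcircuits: those whose closed neighbourhood is a clique. -/
def SMS (C : UniformClutter α d) : Finset (Finset α) :=
  C.MS.filter (fun e => C.IsClique (C.closedNhd e))

/-- `C` is chordal if it can be reduced to a clutter without circuits by successively deleting
simplicial maximal subcircuits (each simplicial in the clutter it is deleted from). -/
inductive Chordal : UniformClutter α d → Prop
  | of_empty (C : UniformClutter α d) : C.circuits = ∅ → Chordal C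
  | step (C : UniformClutter α d) (e : Finset α) :
      e ∈ C.SMS → Chordal (C.deleteFace e) → Chordal C

/-- A free maximal subcircuit: one that is contained in exactly one circuit. -/
def IsFreeMS (C : UniformClutter α d) (e : Finset α) : Prop :=
  e ∈ C.MS ∧ ∃! F, F ∈ C.circuits ∧ e ⊆ F

end UniformClutter

/-- The squarefree monomial `x_F = ∏_{i ∈ F} x_i`. -/
noncomputable def sqfreeMonomial {σ : Type*} (K : Type*) [Field K] (F : Finset σ) :
    MvPolynomial σ K :=
  ∏ i ∈ F, MvPolynomial.X i

/-- `I` has linear quotients with respect to the ordered system of generators `f`: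
each colon ideal `⟨f₁, …, fᵢ₋₁⟩ : fᵢ` is generated by linear forms. -/
def HasLinearQuotientsWrt {σ K : Type*} [Field K] (I : Ideal (MvPolynomial σ K))
    (f : List (MvPolynomial σ K)) : Prop :=
  Ideal.span {p | p ∈ f} = I ∧
    ∀ (i : ℕ) (hi : i < f.length),
      ∃ T : Set (MvPolynomial σ K), (∀ p ∈ T, p.IsHomogeneous 1) ∧
        Submodule.colon (Ideal.span {p | p ∈ f.take i}) {f[i]} = Ideal.span T

/-- A squarefree monomial ideal `I` has linear quotients: it has them with respect to some ordering
of its minimal system of squarefree monomial generators (the `x_F` in `I` with `F` minimal). -/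
def HasLinearQuotients {σ K : Type*} [Field K] (I : Ideal (MvPolynomial σ K)) : Prop :=
  ∃ L : List (Finset σ), L.Nodup ∧
    (∀ F, F ∈ L ↔ Minimal (fun G => sqfreeMonomial K G ∈ I) F) ∧
    HasLinearQuotientsWrt I (L.map (sqfreeMonomial K))

/-- The circuit ideal `I(C)` in the polynomial ring over `K` whose variables are the vertices
of `C`. -/
noncomputable def UniformClutter.circuitIdeal {α : Type*} {d : ℕ} (K : Type*) [Field K]
    (C : UniformClutter α d) : Ideal (MvPolynomial C.verts K) :=
  Ideal.span {p | ∃ F : Finset C.verts,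
    F.map (Function.Embedding.subtype (· ∈ C.verts)) ∈ C.circuits ∧ p = sqfreeMonomial K F}

/-! Simplicial complexes. A complex is a downward closed family of finite sets. The empty face is
allowed, and the complex whose only face is empty differs from the complex without faces, so
`LowerSet (Finset α)` is the fitting notion. -/

/-- The facets (maximal faces) of a simplicial complex. -/
def facets {α : Type*} (Δ : LowerSet (Finset α)) : Set (Finset α) :=
  {F | Maximal (· ∈ Δ) F}

/-- The `k`-skeleton: all faces of dimension at most `k`. -/
def skeleton {α : Type*} (Δ : LowerSet (Finset α)) (k : ℕ) : LowerSet (Finset α) where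
  carrier := {F | F ∈ Δ ∧ F.card ≤ k + 1}
  lower' _ _ h hF := ⟨Δ.lower h hF.1, (Finset.card_le_card h).trans hF.2⟩

/-- `L = (F₁, …, Fₜ)` is a shelling of `Δ`: it lists the facets of `Δ` without repetition, and for
each `i ≥ 2` the complex `⟨F₁, …, Fᵢ₋₁⟩ ∩ ⟨Fᵢ⟩` is pure of dimension `dim Fᵢ - 1`. -/
structure IsShelling {α : Type*} (Δ : LowerSet (Finset α)) (L : List (Finset α)) : Prop where
  nodup : L.Nodup
  mem_iff : ∀ F, F ∈ L ↔ F ∈ facets Δ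
  pure_inter : ∀ (i : ℕ) (hi : i < L.length), 0 < i →
    ∀ F ∈ facets (lowerClosure {G | G ∈ L.take i} ⊓ LowerSet.Iic L[i]), F.card + 1 = L[i].card

/-- `Δ` is extendably shellable: every shelling of a subcomplex whose facets are facets of `Δ` (for
pure `Δ`: a pure subcomplex of the same dimension) can be continued to a shelling of `Δ`. -/
def ExtendablyShellable {α : Type*} (Δ : LowerSet (Finset α)) : Prop :=
  ∀ Γ : LowerSet (Finset α), Γ ≤ Δ → facets Γ ⊆ facets Δ →
    ∀ L, IsShelling Γ L → ∃ L', IsShelling Δ (L ++ L')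

/-- (B), for all uniform clutters with vertices in `α`. -/
def StatementB (α : Type*) [DecidableEq α] (K : Type*) [Field K] : Prop :=
  ∀ (d : ℕ) (C : UniformClutter α d), HasLinearQuotients (C.compl.circuitIdeal K) → C.Chordal

/-- (C), for all uniform clutters with vertices in `α`. -/
def StatementC (α : Type*) [DecidableEq α] : Prop :=
  ∀ (d : ℕ) (C : UniformClutter α d), C.ascent.circuits.Nonempty → C.ascent.Chordal →
    (∀ F ∈ C.ascent.SMS, (C.deleteFace F).Chordal) →
    (∀ v ∈ C.verts, (C.deleteVert v).Chordal) →
    C.SMS.Nonempty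

/-- (D'), for all uniform clutters with vertices in `α` that have at least one circuit. -/
def StatementD' (α : Type*) [DecidableEq α] (K : Type*) [Field K] : Prop :=
  ∀ (d : ℕ) (C : UniformClutter α d), C.circuits.Nonempty → C.ascent.circuits = ∅ →
    HasLinearQuotients (C.compl.circuitIdeal K) → ∃ e, C.IsFreeMS e

/-- Simon's conjecture, for all simplices with vertices in `α`. -/
def SimonConjecture (α : Type*) : Prop :=
  ∀ (V : Finset α) (k : ℕ), ExtendablyShellable (skeleton (LowerSet.Iic V) k)

/-! Linear quotients of `I(C̄)` are a condition on an ordering of the non-circuits of `C`,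
independent of `K`: for each earlier `G`, the current `F` needs a vertex `v ∈ G \ F` and an earlier
`H ⊆ F ∪ {v}` (`LinkedTo`; the translation is `exists_linear_colon_iff`).

This condition survives every operation in (C): removing a vertex restricts the list, the ascent
replaces non-circuits by the sets one larger that contain them, and deleting a simplicial maximal
subcircuit of `C` or of `C⁺` appends the lost circuits to the list. So (B) follows by induction:
(C), or (D') when `C⁺` has no circuits, supplies a simplicial maximal subcircuit, and deleting it
keeps the hypothesis.

Conversely, a chordal clutter with a circuit has a simplicial maximal subcircuit, which is free when
`C⁺` has no circuits; this gives (D'). For (E), taking complements in `V` turns a partial shelling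
of a skeleton into a linked list. Declare its members to be the non-circuits of a clutter. By (B)
that clutter is chordal, and the circuits removed by the successive deletions continue the list,
hence the shelling. -/

/-- The exponent vector of a squarefree monomial. -/
noncomputable def sqfreeExponent {σ : Type*} (F : Finset σ) : σ →₀ ℕ :=
  Finsupp.indicator F fun _ _ => 1

/-- The combinatorial form of the condition that the colon ideal `⟨x_G : G ∈ S⟩ : x_F` is
generated by variables. -/
def LinkedTo {α : Type*} (S : Set (Finset α)) (F : Finset α) : Prop :=
  ∀ G ∈ S, ∃ v ∈ G, v ∉ F ∧ ∃ H ∈ S, ∀ x ∈ H, x = v ∨ x ∈ F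

/-- Each member of the list is linked to the family of its predecessors. -/
def Linked {α : Type*} (L : List (Finset α)) : Prop :=
  ∀ (i : ℕ) (hi : i < L.length), LinkedTo {G | G ∈ L.take i} L[i]

/-- The family `S` can be enumerated without repetition by a linked list. -/
def LinkedFamily {α : Type*} (S : Finset (Finset α)) : Prop :=
  ∃ L : List (Finset α), L.Nodup ∧ (∀ F, F ∈ L ↔ F ∈ S) ∧ Linked L

/-! ### Combinatorics of linked lists. -/

section Linked

variable {α : Type*}

theorem linked_nil : Linked ([] : List (Finset α)) := fun i hi => absurd hi (by simp)

theorem linked_concat {L : List (Finset α)} {F : Finset α} :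
    Linked (L ++ [F]) ↔ Linked L ∧ LinkedTo {G | G ∈ L} F := by
  constructor
  · intro h
    refine ⟨fun i hi => ?_, ?_⟩
    · have := h i (by simp; omega)
      rwa [List.take_append_of_le_length hi.le, List.getElem_append_left hi] at this
    · have := h L.length (by simp)
      simpa using this
  · rintro ⟨h, hF⟩ i hi
    rcases Nat.lt_or_ge i L.length with hlt | hge
    · rw [List.take_append_of_le_length hlt.le, List.getElem_append_left hlt]
      exact h i hlt
    · obtain rfl : i = L.length := by
        simp only [List.length_append, List.length_singleton] at hi
        omega
      simpa using hF

/-- If `F` and `G` avoid `v`, the linking vertex `u ∈ G` differs from `v`, so the witness inside `F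
∪ {u}` avoids `v` and survives the filter. -/
theorem Linked.filter {L : List (Finset α)} (h : Linked L) (v : α)
    [DecidablePred fun F : Finset α => v ∉ F] : Linked (L.filter (v ∉ ·)) := by
  induction L using List.reverseRecOn with
  | nil => exact linked_nil
  | append_singleton L F ih =>
    rw [linked_concat] at h
    rw [List.filter_append]
    by_cases hv : v ∈ F
    · simpa [hv] using ih h.1
    · have : List.filter (fun F => decide (v ∉ F)) [F] = [F] := by simp [hv]
      rw [this, linked_concat]
      refine ⟨ih h.1, fun G hG => ?_⟩
      simp only [Set.mem_ofPred_eq, List.mem_filter, decide_eq_true_eq] at hG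
      obtain ⟨u, huG, huF, H, hH, hsub⟩ := h.2 G hG.1
      refine ⟨u, huG, huF, H, ?_, hsub⟩
      simp only [Set.mem_ofPred_eq, List.mem_filter, decide_eq_true_eq]
      refine ⟨hH, fun hvH => ?_⟩
      rcases hsub v hvH with rfl | hvF
      · exact hG.2 huG
      · exact hv hvF

/-- Distinct one-point extensions of a set `e` are linked to each other. -/
theorem exists_link_of_cone {e G H : Finset α} (hG : e ⊆ G) (hGc : G.card = e.card + 1)
    (hH : e ⊆ H) (hHc : H.card = e.card + 1) (hne : G ≠ H) :
    ∃ v ∈ G, v ∉ H ∧ ∀ x ∈ G, x = v ∨ x ∈ H := by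
  classical
  obtain ⟨v, hv⟩ : ∃ v, G \ e = {v} := by
    rw [← Finset.card_eq_one, Finset.card_sdiff_of_subset hG]; omega
  have hvG : v ∈ G \ e := by simp [hv]
  have key : ∀ x ∈ G, x = v ∨ x ∈ H := by
    intro x hx
    by_cases hxe : x ∈ e
    · exact Or.inr (hH hxe)
    · have : x ∈ G \ e := Finset.mem_sdiff.2 ⟨hx, hxe⟩
      rw [hv, Finset.mem_singleton] at this
      exact Or.inl this
  refine ⟨v, (Finset.mem_sdiff.1 hvG).1, fun hvH => hne ?_, key⟩
  refine Finset.eq_of_subset_of_card_le (fun x hx => ?_) (by omega)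
  rcases key x hx with rfl | h
  · exact hvH
  · exact h

/-- Predecessors within `T` cost nothing: two distinct one-point extensions of `e` differ in one
vertex, so the earlier one is its own witness. Only links to `L` have to be assumed, and the order
of `T` is irrelevant. -/
theorem Linked.append_cone {L T : List (Finset α)} (hL : Linked L) (e : Finset α)
    (hnd : T.Nodup) (hT : ∀ H ∈ T, e ⊆ H ∧ H.card = e.card + 1 ∧ LinkedTo {G | G ∈ L} H) :
    Linked (L ++ T) := by
  induction T using List.reverseRecOn with
  | nil => simpa using hL
  | append_singleton T H ih =>
    rw [List.nodup_append] at hnd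
    rw [← List.append_assoc, linked_concat]
    refine ⟨ih hnd.1 fun G hG => hT G (by simp [hG]), fun G hG => ?_⟩
    obtain ⟨heH, hHc, hlink⟩ := hT H (by simp)
    rcases List.mem_append.1 hG with hG | hG
    · obtain ⟨v, hvG, hvH, H', hH', hsub⟩ := hlink G hG
      exact ⟨v, hvG, hvH, H', List.mem_append_left _ hH', hsub⟩
    · obtain ⟨heG, hGc, -⟩ := hT G (by simp [hG])
      obtain ⟨v, hvG, hvH, hsub⟩ :=
        exists_link_of_cone heG hGc heH hHc (hnd.2.2 G hG H (by simp))
      exact ⟨v, hvG, hvH, G, List.mem_append_right _ hG, hsub⟩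

theorem linkedTo_image_map {β : Type*} (f : α ↪ β) {S : Set (Finset α)} {F : Finset α} :
    LinkedTo (Finset.map f '' S) (F.map f) ↔ LinkedTo S F := by
  have hex : ∀ (G : Finset α) (p : β → Prop), (∃ v ∈ G.map f, p v) ↔ ∃ v ∈ G, p (f v) := by
    simp
  simp only [LinkedTo, Set.forall_mem_image, hex, Set.exists_mem_image, Finset.mem_map',
    Finset.forall_mem_map, EmbeddingLike.apply_eq_iff_eq]

theorem linked_map_map {β : Type*} (f : α ↪ β) {L : List (Finset α)} :
    Linked (L.map (Finset.map f)) ↔ Linked L := by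
  induction L using List.reverseRecOn with
  | nil => simp [linked_nil]
  | append_singleton L F ih =>
    rw [List.map_append, List.map_singleton, linked_concat, linked_concat, ih,
      ← linkedTo_image_map f]
    have : {G | G ∈ L.map (Finset.map f)} = Finset.map f '' {G | G ∈ L} := by
      ext G; simp
    rw [this]

/-- If a family of sets can be enumerated by a linked list, then so can the family of all
`n`-subsets of `V` that contain one of them, where `n` exceeds their common size by one. -/
theorem Linked.linkedFamily_upper [DecidableEq α] {L : List (Finset α)} (hL : Linked L)
    {V : Finset α} {n : ℕ} (hc : ∀ F ∈ L, F.card = n) (hV : ∀ F ∈ L, F ⊆ V) :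
    LinkedFamily ((V.powersetCard (n + 1)).filter fun H => ∃ F ∈ L, F ⊆ H) := by
  induction L using List.reverseRecOn with
  | nil => exact ⟨[], by simp, by simp, linked_nil⟩
  | append_singleton L F ih =>
    rw [linked_concat] at hL
    obtain ⟨M, hMnd, hM, hMl⟩ := ih hL.1 (fun G hG => hc G (by simp [hG]))
      (fun G hG => hV G (by simp [hG]))
    have hFc : F.card = n := hc F (by simp)
    have hFV : F ⊆ V := hV F (by simp)
    simp only [Finset.mem_filter, Finset.mem_powersetCard] at hM
    -- The sets that become new when `F` is added; all are one-point extensions of `F`, so they form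
    -- a cone.
    let T := (V.powersetCard (n + 1)).filter fun H => F ⊆ H ∧ ¬ ∃ G ∈ L, G ⊆ H
    have hT : ∀ H, H ∈ T.toList ↔ (H ⊆ V ∧ H.card = n + 1) ∧ F ⊆ H ∧ ¬ ∃ G ∈ L, G ⊆ H := by
      intro H; simp only [T, Finset.mem_toList, Finset.mem_filter, Finset.mem_powersetCard]
    refine ⟨M ++ T.toList, ?_, ?_, ?_⟩
    · rw [List.nodup_append]
      refine ⟨hMnd, T.nodup_toList, ?_⟩
      rintro G hG _ hH rfl
      exact ((hT G).1 hH).2.2 ((hM G).1 hG).2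
    · intro H
      rw [List.mem_append, hM, hT]
      simp only [Finset.mem_filter, Finset.mem_powersetCard, List.mem_append, List.mem_singleton,
        or_and_right, exists_or, exists_eq_left]
      by_cases hL : ∃ G ∈ L, G ⊆ H <;> simp [hL]
    · refine hMl.append_cone F T.nodup_toList fun H hH => ?_
      obtain ⟨⟨hHV, hHc⟩, hFH, hno⟩ := (hT H).1 hH
      refine ⟨hFH, by omega, fun G hG => ?_⟩
      obtain ⟨⟨hGV, hGc⟩, G', hG'L, hG'⟩ := (hM G).1 hG
      -- The link of `F` to `G'` lifts to `H`: if `u` were in `H`, then `G'' ⊆ F ∪ {u} ⊆ H` would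
      -- contradict the newness of `H`. The witness is `F ∪ {u}`, already listed because it contains
      -- `G''`.
      obtain ⟨u, huG', huF, G'', hG''L, hsub⟩ := hL.2 G' hG'L
      have huH : u ∉ H := by
        intro huH
        refine hno ⟨G'', hG''L, fun x hx => ?_⟩
        rcases hsub x hx with rfl | hx
        · exact huH
        · exact hFH hx
      refine ⟨u, hG' huG', huH, insert u F, (hM _).2 ⟨⟨?_, ?_⟩, G'', hG''L, ?_⟩, ?_⟩
      · exact Finset.insert_subset (hGV (hG' huG')) hFV
      · rw [Finset.card_insert_of_notMem huF, hFc]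
      · intro x hx; rw [Finset.mem_insert]; exact hsub x hx
      · intro x hx
        rcases Finset.mem_insert.1 hx with rfl | hx
        · exact Or.inl rfl
        · exact Or.inr (hFH hx)

end Linked

/-! ### Linear quotients translated into linked lists. -/

section Ideal

open MvPolynomial

variable {σ : Type*} {K : Type*} [Field K]

theorem sqfreeExponent_le_iff {F : Finset σ} {m : σ →₀ ℕ} :
    sqfreeExponent F ≤ m ↔ F ⊆ m.support := by
  classical
  rw [Finsupp.le_def]
  simp only [sqfreeExponent, Finsupp.indicator_apply, Finset.subset_iff, Finsupp.mem_support_iff]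
  refine forall_congr' fun i => ?_
  by_cases hi : i ∈ F <;> simp [hi, Nat.one_le_iff_ne_zero]

theorem support_sqfreeExponent (F : Finset σ) : (sqfreeExponent F).support = F := by
  classical
  ext i
  simp [sqfreeExponent, Finsupp.indicator_apply]

theorem sqfreeMonomial_eq_monomial (F : Finset σ) :
    sqfreeMonomial K F = monomial (sqfreeExponent F) 1 := by
  classical
  have : sqfreeExponent F = ∑ i ∈ F, Finsupp.single i 1 := by
    ext j
    simp [sqfreeExponent, Finsupp.indicator_apply, Finsupp.finsetSum_apply,
      Finsupp.single_apply]
  rw [this, sqfreeMonomial, monomial_sum_one]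
  rfl

theorem mem_span_sqfreeMonomial {S : Set (Finset σ)} {p : MvPolynomial σ K} :
    p ∈ Ideal.span (sqfreeMonomial K '' S) ↔ ∀ m ∈ p.support, ∃ F ∈ S, F ⊆ m.support := by
  have : sqfreeMonomial K '' S = (fun s => monomial s (1 : K)) '' (sqfreeExponent '' S) := by
    rw [Set.image_image]
    exact Set.image_congr fun F _ => sqfreeMonomial_eq_monomial F
  rw [this, mem_ideal_span_monomial_image]
  simp only [Set.exists_mem_image, sqfreeExponent_le_iff]

theorem sqfreeMonomial_mem_span {S : Set (Finset σ)} {G : Finset σ} :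
    sqfreeMonomial K G ∈ Ideal.span (sqfreeMonomial K '' S) ↔ ∃ F ∈ S, F ⊆ G := by
  classical
  rw [mem_span_sqfreeMonomial, sqfreeMonomial_eq_monomial, support_monomial,
    if_neg one_ne_zero]
  simp [support_sqfreeExponent]

theorem mem_colon_sqfreeMonomial {S : Set (Finset σ)} {F : Finset σ} {p : MvPolynomial σ K} :
    p ∈ Submodule.colon (Ideal.span (sqfreeMonomial K '' S)) {sqfreeMonomial K F} ↔
      ∀ m ∈ p.support, ∃ G ∈ S, ∀ x ∈ G, m x ≠ 0 ∨ x ∈ F := by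
  classical
  rw [Submodule.mem_colon_singleton, smul_eq_mul, mem_span_sqfreeMonomial,
    sqfreeMonomial_eq_monomial]
  have hsub : ∀ (m : σ →₀ ℕ) (G : Finset σ), G ⊆ (m + sqfreeExponent F).support ↔
      ∀ x ∈ G, m x ≠ 0 ∨ x ∈ F := by
    intro m G
    simp only [Finset.subset_iff, Finsupp.mem_support_iff, Finsupp.add_apply, sqfreeExponent,
      Finsupp.indicator_apply]
    refine forall₂_congr fun x _ => ?_
    by_cases hx : x ∈ F <;> simp [hx]
  constructor
  · intro h m hm
    obtain ⟨G, hG, hGs⟩ := h (m + sqfreeExponent F) (by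
      rw [mem_support_iff, coeff_mul_monomial, mul_one]; exact mem_support_iff.1 hm)
    exact ⟨G, hG, (hsub m G).1 hGs⟩
  · intro h m hm
    rw [mem_support_iff, coeff_mul_monomial'] at hm
    have hle : sqfreeExponent F ≤ m := by
      by_contra hle
      exact hm (if_neg hle)
    rw [if_pos hle, mul_one] at hm
    obtain ⟨G, hG, hGs⟩ := h _ (mem_support_iff.2 hm)
    refine ⟨G, hG, ?_⟩
    rw [← hsub, tsub_add_cancel_of_le hle] at hGs
    exact hGs

/-- The colon is a monomial ideal, and `W` collects the variables in it. Any linear form in the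
colon has all its terms in `W`, so generation by linear forms means generation by `W`. Since `x_{G \
F}` lies in the colon, it must then be divisible by a variable of `W`, which is the link. -/
theorem exists_linear_colon_iff {S : Set (Finset σ)} {F : Finset σ} :
    (∃ T : Set (MvPolynomial σ K), (∀ p ∈ T, p.IsHomogeneous 1) ∧
      Submodule.colon (Ideal.span (sqfreeMonomial K '' S)) {sqfreeMonomial K F} =
        Ideal.span T) ↔ LinkedTo S F := by
  classical
  let W : Set σ := {v | ∃ H ∈ S, ∀ x ∈ H, x = v ∨ x ∈ F}
  constructor
  · rintro ⟨T, hT, hcolon⟩ G hG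
    have hle : Ideal.span T ≤ Ideal.span (X '' W : Set (MvPolynomial σ K)) := by
      rw [Ideal.span_le]
      intro p hp
      have hpc : p ∈ Submodule.colon (Ideal.span (sqfreeMonomial K '' S))
          {sqfreeMonomial K F} := hcolon ▸ Ideal.subset_span hp
      rw [mem_colon_sqfreeMonomial] at hpc
      rw [SetLike.mem_coe, mem_ideal_span_X_image]
      intro m hm
      have hdeg : m.degree = 1 := by
        have := hT p hp (mem_support_iff.1 hm)
        rw [Finsupp.degree_eq_weight_one]
        exact this
      obtain ⟨v, rfl⟩ := (Finsupp.sum_eq_one_iff m).1 hdeg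
      obtain ⟨H, hH, hsub⟩ := hpc _ hm
      refine ⟨v, ⟨H, hH, fun x hx => ?_⟩, by simp⟩
      refine (hsub x hx).imp_left fun h => ?_
      by_contra hne
      exact h (Finsupp.single_eq_of_ne hne)
    have hmem : sqfreeMonomial K (G \ F) ∈ Ideal.span (X '' W : Set (MvPolynomial σ K)) := by
      apply hle
      rw [← hcolon, mem_colon_sqfreeMonomial, sqfreeMonomial_eq_monomial, support_monomial,
        if_neg one_ne_zero]
      intro m hm
      rw [Finset.mem_singleton] at hm
      refine ⟨G, hG, fun x hx => ?_⟩
      rw [← Finsupp.mem_support_iff, hm, support_sqfreeExponent, Finset.mem_sdiff]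
      tauto
    rw [mem_ideal_span_X_image, sqfreeMonomial_eq_monomial, support_monomial,
      if_neg one_ne_zero] at hmem
    obtain ⟨v, ⟨H, hH, hsub⟩, hv⟩ := hmem _ (Finset.mem_singleton_self _)
    rw [← Finsupp.mem_support_iff, support_sqfreeExponent, Finset.mem_sdiff] at hv
    exact ⟨v, hv.1, hv.2, H, hH, hsub⟩
  · intro h
    refine ⟨X '' W, ?_, ?_⟩
    · rintro _ ⟨v, -, rfl⟩
      exact isHomogeneous_X K v
    · ext p
      rw [mem_colon_sqfreeMonomial, mem_ideal_span_X_image]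
      refine forall₂_congr fun m _ => ⟨?_, ?_⟩
      · rintro ⟨G, hG, hsub⟩
        obtain ⟨v, hvG, hvF, H, hH, hHs⟩ := h G hG
        exact ⟨v, ⟨H, hH, hHs⟩, (hsub v hvG).resolve_right hvF⟩
      · rintro ⟨v, ⟨H, hH, hHs⟩, hv⟩
        refine ⟨H, hH, fun x hx => (hHs x hx).imp_left ?_⟩
        rintro rfl
        exact hv

theorem span_mem_map_sqfreeMonomial (L : List (Finset σ)) :
    Ideal.span {p | p ∈ L.map (sqfreeMonomial K)} =
      Ideal.span (sqfreeMonomial K '' {G | G ∈ L}) := by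
  congr 1
  ext p
  simp

theorem hasLinearQuotientsWrt_map_sqfreeMonomial {I : Ideal (MvPolynomial σ K)}
    {L : List (Finset σ)} :
    HasLinearQuotientsWrt I (L.map (sqfreeMonomial K)) ↔
      Ideal.span (sqfreeMonomial K '' {G | G ∈ L}) = I ∧ Linked L := by
  rw [HasLinearQuotientsWrt, span_mem_map_sqfreeMonomial]
  refine and_congr_right fun _ => ?_
  simp only [List.length_map, List.getElem_map, ← List.map_take, span_mem_map_sqfreeMonomial,
    exists_linear_colon_iff]
  rfl

theorem UniformClutter.circuitIdeal_eq_span {α : Type*} {d : ℕ} (C : UniformClutter α d) :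
    C.circuitIdeal K = Ideal.span (sqfreeMonomial K ''
      {F | F.map (Function.Embedding.subtype (· ∈ C.verts)) ∈ C.circuits}) := by
  rw [UniformClutter.circuitIdeal]
  congr 1
  ext p
  simp [eq_comm]

/-- All circuits have the same size, so none properly contains another and every generator is
minimal. -/
theorem UniformClutter.minimal_sqfreeMonomial_mem_circuitIdeal {α : Type*} {d : ℕ}
    (C : UniformClutter α d) (F : Finset C.verts) :
    Minimal (fun G => sqfreeMonomial K G ∈ C.circuitIdeal K) F ↔
      F.map (Function.Embedding.subtype (· ∈ C.verts)) ∈ C.circuits := by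
  simp only [C.circuitIdeal_eq_span, sqfreeMonomial_mem_span, Set.mem_ofPred_eq]
  constructor
  · rintro ⟨⟨G, hG, hGF⟩, hmin⟩
    have := hmin ⟨G, hG, subset_rfl⟩ hGF
    rwa [le_antisymm this hGF]
  · intro hF
    refine ⟨⟨F, hF, subset_rfl⟩, ?_⟩
    rintro G ⟨H, hH, hHG⟩ hGF
    have hHF : H = F := by
      refine Finset.eq_of_subset_of_card_le (hHG.trans hGF) ?_
      have h1 := C.card_eq _ hF
      have h2 := C.card_eq _ hH
      rw [Finset.card_map] at h1 h2
      omega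
    exact hHF ▸ hHG

/-- Linear quotients of a circuit ideal are a combinatorial property of the circuits. -/
theorem UniformClutter.hasLinearQuotients_circuitIdeal {α : Type*} {d : ℕ}
    (C : UniformClutter α d) :
    HasLinearQuotients (C.circuitIdeal K) ↔ LinkedFamily C.circuits := by
  classical
  simp only [HasLinearQuotients, C.minimal_sqfreeMonomial_mem_circuitIdeal,
    hasLinearQuotientsWrt_map_sqfreeMonomial, LinkedFamily]
  constructor
  · rintro ⟨L, hnd, hmem, -, hL⟩
    refine ⟨L.map (Finset.map (Function.Embedding.subtype _)),
      hnd.map (Finset.map_injective _), fun F => ?_, (linked_map_map _).2 hL⟩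
    rw [List.mem_map]
    constructor
    · rintro ⟨G, hG, rfl⟩
      exact (hmem G).1 hG
    · intro hF
      have hmap := Finset.subtype_map_of_mem (p := (· ∈ C.verts))
        fun x hx => C.subset_verts F hF hx
      refine ⟨F.subtype (· ∈ C.verts), (hmem _).2 ?_, hmap⟩
      rwa [hmap]
  · rintro ⟨L, hnd, hmem, hL⟩
    have hmap : ∀ F ∈ L, (F.subtype (· ∈ C.verts)).map
        (Function.Embedding.subtype (· ∈ C.verts)) = F := fun F hF =>
      Finset.subtype_map_of_mem fun x hx => C.subset_verts F ((hmem F).1 hF) hx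
    obtain ⟨M, rfl⟩ : ∃ M : List (Finset C.verts),
        L = M.map (Finset.map (Function.Embedding.subtype (· ∈ C.verts))) := by
      refine ⟨L.map fun F => F.subtype (· ∈ C.verts), ?_⟩
      rw [List.map_map]
      conv_lhs => rw [← List.map_id L]
      exact List.map_congr_left fun F hF => (hmap F hF).symm
    have hM : ∀ F, F ∈ M ↔ F.map (Function.Embedding.subtype (· ∈ C.verts)) ∈ C.circuits := by
      intro F
      rw [← hmem, List.mem_map_of_injective (Finset.map_injective _)]
    refine ⟨M, hnd.of_map _, hM, ?_, (linked_map_map _).1 hL⟩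
    rw [C.circuitIdeal_eq_span]
    congr 2
    ext F
    exact hM F

end Ideal

/-! ### Clutter operations that preserve linkedness, and the induction for (B). -/

namespace UniformClutter

variable {α : Type*} {d : ℕ}

theorem IsClique.mem_circuits {C : UniformClutter α d} {A F : Finset α} (h : C.IsClique A)
    (hF : F ⊆ A) (hc : F.card = d + 1) : F ∈ C.circuits :=
  h.2 F (Finset.mem_powersetCard.2 ⟨hF, hc⟩)

variable [DecidableEq α]

theorem mem_compl_circuits {C : UniformClutter α d} {F : Finset α} :
    F ∈ C.compl.circuits ↔ (F ⊆ C.verts ∧ F.card = d + 1) ∧ F ∉ C.circuits := by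
  simp [compl]

theorem mem_ascent_circuits {C : UniformClutter α d} {F : Finset α} :
    F ∈ C.ascent.circuits ↔ (F ⊆ C.verts ∧ F.card = d + 2) ∧ C.IsClique F := by
  simp [ascent]

theorem mem_MS {C : UniformClutter α d} {e : Finset α} :
    e ∈ C.MS ↔ (e ⊆ C.verts ∧ e.card = d) ∧ ∃ F ∈ C.circuits, e ⊆ F := by
  simp [MS]

theorem mem_SMS {C : UniformClutter α d} {e : Finset α} :
    e ∈ C.SMS ↔ e ∈ C.MS ∧ C.IsClique (C.closedNhd e) := by
  simp [SMS]

theorem mem_closedNhd {C : UniformClutter α d} {e : Finset α} {v : α} :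
    v ∈ C.closedNhd e ↔ v ∈ e ∨ v ∈ C.verts ∧ insert v e ∈ C.circuits := by
  simp [closedNhd]

theorem subset_closedNhd {C : UniformClutter α d} {e F : Finset α} (he : e.card = d)
    (hF : F ∈ C.circuits) (heF : e ⊆ F) : F ⊆ C.closedNhd e := by
  intro v hv
  rw [mem_closedNhd]
  by_cases hve : v ∈ e
  · exact Or.inl hve
  · refine Or.inr ⟨C.subset_verts F hF hv, ?_⟩
    rwa [Finset.eq_of_subset_of_card_le (Finset.insert_subset hv heF)
      (by rw [Finset.card_insert_of_notMem hve, he, C.card_eq F hF])]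

/-- A circuit through a simplicial maximal subcircuit is linked to the family of non-circuits. -/
theorem linkedTo_of_mem_SMS {C : UniformClutter α d} {e H : Finset α} (he : e ∈ C.SMS)
    (hH : H ∈ C.circuits) (heH : e ⊆ H) :
    LinkedTo {G | G ∈ C.compl.circuits} H := by
  rw [mem_SMS, mem_MS] at he
  obtain ⟨⟨⟨heV, hec⟩, -⟩, hcl⟩ := he
  intro G hG
  obtain ⟨⟨hGV, hGc⟩, hGC⟩ := mem_compl_circuits.1 hG
  obtain ⟨v, hvG, hv⟩ : ∃ v ∈ G, v ∉ C.closedNhd e := by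
    by_contra! h
    exact hGC (hcl.mem_circuits h hGc)
  have hvH : v ∉ H := fun h => hv (subset_closedNhd hec hH heH h)
  have hve : v ∉ e := fun h => hvH (heH h)
  refine ⟨v, hvG, hvH, insert v e, mem_compl_circuits.2 ⟨⟨?_, ?_⟩, fun h => ?_⟩, ?_⟩
  · exact Finset.insert_subset (hGV hvG) heV
  · rw [Finset.card_insert_of_notMem hve, hec]
  · exact hv (mem_closedNhd.2 (Or.inr ⟨hGV hvG, h⟩))
  · intro x hx
    exact (Finset.mem_insert.1 hx).imp_right fun h => heH h

/-- The circuits through `e` form a cone over `e`, each linked to the non-circuits because `N[e]` is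
a clique. The old list is kept as a prefix, as extending shellings requires. -/
theorem exists_linked_append_deleteFace {C : UniformClutter α d} {e : Finset α} (he : e ∈ C.SMS)
    {L : List (Finset α)} (hnd : L.Nodup) (hmem : ∀ F, F ∈ L ↔ F ∈ C.compl.circuits)
    (hL : Linked L) :
    ∃ T : List (Finset α), (L ++ T).Nodup ∧
      (∀ F, F ∈ L ++ T ↔ F ∈ (C.deleteFace e).compl.circuits) ∧ Linked (L ++ T) := by
  have hT : ∀ F, F ∈ (C.circuits.filter (e ⊆ ·)).toList ↔ F ∈ C.circuits ∧ e ⊆ F := by simp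
  refine ⟨(C.circuits.filter (e ⊆ ·)).toList, ?_, fun F => ?_, ?_⟩
  · rw [List.nodup_append]
    refine ⟨hnd, Finset.nodup_toList _, ?_⟩
    rintro F hF _ hF' rfl
    exact (mem_compl_circuits.1 ((hmem F).1 hF)).2 ((hT F).1 hF').1
  · rw [List.mem_append, hmem, hT, mem_compl_circuits, mem_compl_circuits]
    have h1 := C.subset_verts F
    have h2 := C.card_eq F
    simp only [deleteFace, Finset.mem_filter]
    tauto
  · refine hL.append_cone e (Finset.nodup_toList _) fun H hH => ?_
    obtain ⟨hHC, heH⟩ := (hT H).1 hH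
    refine ⟨heH, ?_, ?_⟩
    · rw [C.card_eq H hHC, (mem_MS.1 (mem_SMS.1 he).1).1.2]
    · simp only [hmem]
      exact linkedTo_of_mem_SMS he hHC heH

theorem linkedFamily_compl_deleteFace {C : UniformClutter α d} {e : Finset α} (he : e ∈ C.SMS)
    (h : LinkedFamily C.compl.circuits) : LinkedFamily (C.deleteFace e).compl.circuits := by
  obtain ⟨L, hnd, hmem, hL⟩ := h
  obtain ⟨T, hT⟩ := exists_linked_append_deleteFace he hnd hmem hL
  exact ⟨L ++ T, hT⟩

theorem linkedFamily_compl_deleteVert {C : UniformClutter α d} (v : α)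
    (h : LinkedFamily C.compl.circuits) : LinkedFamily (C.deleteVert v).compl.circuits := by
  obtain ⟨L, hnd, hmem, hL⟩ := h
  refine ⟨L.filter (v ∉ ·), hnd.filter _, fun F => ?_, hL.filter v⟩
  rw [List.mem_filter, hmem, mem_compl_circuits, mem_compl_circuits]
  simp only [deleteVert, Finset.mem_filter, Finset.subset_erase, decide_eq_true_eq]
  tauto

/-- A `(d + 2)`-set of vertices fails to be a clique exactly when it contains a non-circuit. -/
theorem linkedFamily_compl_ascent {C : UniformClutter α d}
    (h : LinkedFamily C.compl.circuits) : LinkedFamily C.ascent.compl.circuits := by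
  obtain ⟨L, -, hmem, hL⟩ := h
  have hL' := hL.linkedFamily_upper (V := C.verts) (n := d + 1)
    (fun F hF => (mem_compl_circuits.1 ((hmem F).1 hF)).1.2)
    (fun F hF => (mem_compl_circuits.1 ((hmem F).1 hF)).1.1)
  convert hL' using 1
  ext H
  simp only [mem_compl_circuits, mem_ascent_circuits, Finset.mem_filter,
    Finset.mem_powersetCard, hmem, IsClique]
  constructor
  · rintro ⟨⟨hHV, hHc⟩, hH⟩
    have hHV' : H ⊆ C.verts := hHV
    refine ⟨⟨hHV', hHc⟩, ?_⟩
    by_contra! hno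
    refine hH ⟨⟨hHV', hHc⟩, hHV', fun F hF => ?_⟩
    by_contra hFC
    exact hno F ⟨⟨hF.1.trans hHV', hF.2⟩, hFC⟩ hF.1
  · rintro ⟨⟨hHV, hHc⟩, F, ⟨⟨hFV, hFc⟩, hFC⟩, hFH⟩
    exact ⟨⟨hHV, hHc⟩, fun h => hFC (h.2.2 F ⟨hFH, hFc⟩)⟩

theorem mem_circuits_of_mem_MS_ascent {C : UniformClutter α d} {F : Finset α}
    (hF : F ∈ C.ascent.MS) : F ∈ C.circuits := by
  obtain ⟨⟨-, hFc⟩, H, hH, hFH⟩ := mem_MS.1 hF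
  exact (mem_ascent_circuits.1 hH).2.mem_circuits hFH hFc

/-- Here `F` is a circuit of `C`, so only `F` itself is lost. A non-circuit `G` has a vertex `v`
outside `N[F]` taken in `C⁺`; then `F ∪ {v}` is not a clique of `C`, and a non-circuit inside it is
the witness. -/
theorem linkedFamily_compl_deleteFace_of_mem_SMS_ascent {C : UniformClutter α d} {F : Finset α}
    (hF : F ∈ C.ascent.SMS) (h : LinkedFamily C.compl.circuits) :
    LinkedFamily (C.deleteFace F).compl.circuits := by
  have hFC := mem_circuits_of_mem_MS_ascent (mem_SMS.1 hF).1
  obtain ⟨hMS, hcl⟩ := mem_SMS.1 hF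
  obtain ⟨⟨hFV, hFc⟩, H, hH, hFH⟩ := mem_MS.1 hMS
  have hFV' : F ⊆ C.verts := hFV
  obtain ⟨L, hnd, hmem, hL⟩ := h
  refine ⟨L ++ [F], ?_, fun G => ?_, linked_concat.2 ⟨hL, fun G hG => ?_⟩⟩
  · rw [List.nodup_append]
    refine ⟨hnd, by simp, ?_⟩
    rintro G hG _ hG' rfl
    rw [List.mem_singleton.1 hG'] at hG
    exact (mem_compl_circuits.1 ((hmem F).1 hG)).2 hFC
  · have key : G ∈ C.circuits → (F ⊆ G ↔ G = F) := fun hG =>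
      ⟨fun hFG => (Finset.eq_of_subset_of_card_le hFG (by rw [C.card_eq G hG, hFc])).symm,
        fun h => h ▸ subset_rfl⟩
    have hGF : G = F → G ∈ C.circuits := fun h => h ▸ hFC
    have h1 := C.subset_verts G
    have h2 := C.card_eq G
    rw [List.mem_append, hmem, mem_compl_circuits, mem_compl_circuits, List.mem_singleton]
    simp only [deleteFace, Finset.mem_filter]
    tauto
  · obtain ⟨⟨hGV, hGc⟩, hGC⟩ := mem_compl_circuits.1 ((hmem G).1 hG)
    obtain ⟨v, hvG, hv⟩ : ∃ v ∈ G, v ∉ C.ascent.closedNhd F := by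
      by_contra! hsub
      have hHc : H.card = d + 2 := (mem_ascent_circuits.1 hH).1.2
      have hcard : d + 2 ≤ (C.ascent.closedNhd F).card :=
        hHc ▸ Finset.card_le_card (subset_closedNhd hFc hH hFH)
      -- Were `G` inside `N[F]`, it could be enlarged there to a `(d + 2)`-set, which is a circuit
      -- of `C⁺` and hence a clique of `C` containing `G`.
      obtain ⟨A, hGA, hA, hAc⟩ :=
        Finset.exists_subsuperset_card_eq (n := d + 2) hsub (by omega) hcard
      exact hGC ((mem_ascent_circuits.1 (hcl.mem_circuits hA hAc)).2.mem_circuits hGA hGc)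
    have hvF : v ∉ F := fun h => hv (mem_closedNhd.2 (Or.inl h))
    have hvV : insert v F ⊆ C.verts := Finset.insert_subset (hGV hvG) hFV'
    have hnot : ¬ C.IsClique (insert v F) := fun h =>
      hv (mem_closedNhd.2 (Or.inr ⟨hGV hvG, mem_ascent_circuits.2
        ⟨⟨hvV, by rw [Finset.card_insert_of_notMem hvF, hFc]⟩, h⟩⟩))
    simp only [IsClique, hvV, true_and, not_forall, Finset.mem_powersetCard] at hnot
    obtain ⟨G', ⟨hG's, hG'c⟩, hG'⟩ := hnot
    exact ⟨v, hvG, hvF, G', (hmem G').2 (mem_compl_circuits.2 ⟨⟨hG's.trans hvV, hG'c⟩, hG'⟩),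
      fun x hx => Finset.mem_insert.1 (hG's hx)⟩

theorem IsFreeMS.mem_SMS {C : UniformClutter α d} {e : Finset α} (h : C.IsFreeMS e) :
    e ∈ C.SMS := by
  obtain ⟨hMS, F, ⟨hF, heF⟩, huniq⟩ := h
  obtain ⟨⟨heV, hec⟩, -⟩ := mem_MS.1 hMS
  have hN : C.closedNhd e = F := by
    refine Finset.Subset.antisymm (fun v hv => ?_) (subset_closedNhd hec hF heF)
    rcases mem_closedNhd.1 hv with hv | ⟨-, hv⟩
    · exact heF hv
    · rw [← huniq _ ⟨hv, Finset.subset_insert v e⟩]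
      exact Finset.mem_insert_self v e
  refine UniformClutter.mem_SMS.2 ⟨hMS, hN ▸ ⟨C.subset_verts F hF, fun G hG => ?_⟩⟩
  rw [Finset.mem_powersetCard] at hG
  rwa [Finset.eq_of_subset_of_card_le hG.1 (by rw [hG.2, C.card_eq F hF])]

/-- A clique on `d + 2` or more vertices would contain a circuit of `C⁺`, so `N[e]` has at most `d +
1` vertices and equals every circuit through `e`. -/
theorem isFreeMS_of_mem_SMS {C : UniformClutter α d} (hasc : C.ascent.circuits = ∅)
    {e : Finset α} (he : e ∈ C.SMS) : C.IsFreeMS e := by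
  obtain ⟨hMS, hcl⟩ := mem_SMS.1 he
  obtain ⟨⟨heV, hec⟩, F, hF, heF⟩ := mem_MS.1 hMS
  have hcard : (C.closedNhd e).card ≤ d + 1 := by
    by_contra! hlt
    obtain ⟨A, hA, hAc⟩ := Finset.exists_subset_card_eq (n := d + 2) hlt
    have hAV : A ⊆ C.verts := hA.trans hcl.1
    have : A ∈ C.ascent.circuits := mem_ascent_circuits.2 ⟨⟨hAV, hAc⟩, hAV, fun G hG =>
      hcl.mem_circuits ((Finset.mem_powersetCard.1 hG).1.trans hA)
        (Finset.mem_powersetCard.1 hG).2⟩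
    simp [hasc] at this
  have key : ∀ G ∈ C.circuits, e ⊆ G → G = C.closedNhd e := fun G hG heG =>
    Finset.eq_of_subset_of_card_le (subset_closedNhd hec hG heG) (by rwa [C.card_eq G hG])
  exact ⟨hMS, F, ⟨hF, heF⟩, fun G hG => (key G hG.1 hG.2).trans (key F hF heF).symm⟩

theorem Chordal.SMS_nonempty {C : UniformClutter α d} (h : C.Chordal)
    (hne : C.circuits.Nonempty) : C.SMS.Nonempty := by
  cases h with
  | of_empty _ h => simp [h] at hne
  | step _ e he _ => exact ⟨e, he⟩

theorem card_circuits_deleteFace_lt {C : UniformClutter α d} {e F : Finset α}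
    (hF : F ∈ C.circuits) (heF : e ⊆ F) : (C.deleteFace e).circuits.card < C.circuits.card :=
  Finset.card_lt_card (Finset.filter_ssubset.2 ⟨F, hF, not_not.2 heF⟩)

/-- A linked enumeration of the non-circuits of a chordal clutter extends to a linked enumeration
of all sets of vertices of the same size. -/
theorem Chordal.exists_linked_append {C : UniformClutter α d} (h : C.Chordal) :
    ∀ {L : List (Finset α)}, L.Nodup → (∀ F, F ∈ L ↔ F ∈ C.compl.circuits) → Linked L →
      ∃ T : List (Finset α), (L ++ T).Nodup ∧
        (∀ F, F ∈ L ++ T ↔ F ∈ C.verts.powersetCard (d + 1)) ∧ Linked (L ++ T) := by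
  induction h with
  | of_empty C hC =>
    intro L hnd hmem hL
    refine ⟨[], by simpa using hnd, fun F => ?_, by simpa using hL⟩
    simp [hmem, compl, hC]
  | step C e he _ ih =>
    intro L hnd hmem hL
    obtain ⟨T, hnd', hmem', hL'⟩ := exists_linked_append_deleteFace he hnd hmem hL
    obtain ⟨T', hT'⟩ := ih hnd' hmem' hL'
    refine ⟨T ++ T', ?_⟩
    rw [← List.append_assoc]
    exact hT'

/-- Under (C) and (D'), a clutter whose non-circuits form a linked family is chordal. -/
theorem chordal_of_linkedFamily_compl {K : Type*} [Field K] (hC : StatementC α)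
    (hD : StatementD' α K) {d : ℕ} (C : UniformClutter α d)
    (h : LinkedFamily C.compl.circuits) : C.Chordal := by
  rcases C.circuits.eq_empty_or_nonempty with hemp | hne
  · exact .of_empty C hemp
  -- Needed so that the truncated difference `C.verts.card - d` really drops when `d` grows by one
  -- in the ascent.
  have hd : d < C.verts.card := by
    obtain ⟨F, hF⟩ := hne
    have := Finset.card_le_card (C.subset_verts F hF)
    rw [C.card_eq F hF] at this
    omega
  have hdel : ∀ e F, F ∈ C.circuits → e ⊆ F →
      LinkedFamily (C.deleteFace e).compl.circuits → (C.deleteFace e).Chordal := by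
    intro e F hF heF hlf
    have := card_circuits_deleteFace_lt hF heF
    exact chordal_of_linkedFamily_compl hC hD _ hlf
  obtain ⟨e, he⟩ : C.SMS.Nonempty := by
    rcases C.ascent.circuits.eq_empty_or_nonempty with hasc | hasc
    · obtain ⟨e, he⟩ := hD d C hne hasc ((C.compl.hasLinearQuotients_circuitIdeal).2 h)
      exact ⟨e, he.mem_SMS⟩
    · refine hC d C hasc ?_ (fun F hF => ?_) (fun v hv => ?_)
      · have : C.verts.card - (d + 1) < C.verts.card - d := by omega
        exact chordal_of_linkedFamily_compl hC hD _ (linkedFamily_compl_ascent h)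
      · exact hdel F F (mem_circuits_of_mem_MS_ascent (UniformClutter.mem_SMS.1 hF).1) subset_rfl
          (linkedFamily_compl_deleteFace_of_mem_SMS_ascent hF h)
      · have : (C.verts.erase v).card < C.verts.card := Finset.card_erase_lt_of_mem hv
        exact chordal_of_linkedFamily_compl hC hD _ (linkedFamily_compl_deleteVert v h)
  obtain ⟨-, F, hF, heF⟩ := mem_MS.1 (UniformClutter.mem_SMS.1 he).1
  exact .step C e he (hdel e F hF heF (linkedFamily_compl_deleteFace he h))
-- Removing a vertex lowers the first entry; the ascent keeps it and lowers the second; deleting a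
-- face keeps both and lowers the third.
termination_by (C.verts.card, C.verts.card - d, C.circuits.card)
decreasing_by
  · exact Prod.Lex.right _ (Prod.Lex.right _ this)
  · exact Prod.Lex.right _ (Prod.Lex.left _ _ this)
  · exact Prod.Lex.left _ _ this

end UniformClutter

/-! ### Shellings of skeleta and Alexander duality. -/

section Shelling

variable {α : Type*}

theorem mem_skeleton_Iic {V F : Finset α} {k : ℕ} :
    F ∈ skeleton (LowerSet.Iic V) k ↔ F ⊆ V ∧ F.card ≤ k + 1 := Iff.rfl

theorem mem_facets_skeleton_Iic {V F : Finset α} {k : ℕ} (hk : k + 1 ≤ V.card) :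
    F ∈ facets (skeleton (LowerSet.Iic V) k) ↔ F ⊆ V ∧ F.card = k + 1 := by
  constructor
  · rintro ⟨hF, hmax⟩
    obtain ⟨hFV, hFc⟩ := mem_skeleton_Iic.1 hF
    obtain ⟨A, hFA, hAV, hAc⟩ := Finset.exists_subsuperset_card_eq hFV hFc hk
    have := hmax (mem_skeleton_Iic.2 ⟨hAV, hAc.le⟩) hFA
    exact ⟨hFV, hFA.antisymm this ▸ hAc⟩
  · rintro ⟨hFV, hFc⟩
    refine ⟨mem_skeleton_Iic.2 ⟨hFV, hFc.le⟩, fun G hG hFG => ?_⟩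
    exact (Finset.eq_of_subset_of_card_le hFG
      ((mem_skeleton_Iic.1 hG).2.trans hFc.ge)).ge

theorem mem_facets_skeleton_Iic_of_card_le {V F : Finset α} {k : ℕ} (hk : V.card ≤ k + 1) :
    F ∈ facets (skeleton (LowerSet.Iic V) k) ↔ F = V := by
  have hV : V ∈ skeleton (LowerSet.Iic V) k := mem_skeleton_Iic.2 ⟨subset_rfl, hk⟩
  constructor
  · rintro ⟨hF, hmax⟩
    have hFV := (mem_skeleton_Iic.1 hF).1
    exact hFV.antisymm (hmax hV hFV)
  · rintro rfl
    exact ⟨hV, fun G hG _ => (mem_skeleton_Iic.1 hG).1⟩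

/-- The skeleton is the full simplex, with the single facet `V`, so a partial shelling is `[]` or
`[V]`. -/
theorem extendablyShellable_skeleton_of_card_le {V : Finset α} {k : ℕ} (hk : V.card ≤ k + 1) :
    ExtendablyShellable (skeleton (LowerSet.Iic V) k) := by
  intro Γ _ hΓ L hL
  have hLV : ∀ F ∈ L, F = V := fun F hF =>
    (mem_facets_skeleton_Iic_of_card_le hk).1 (hΓ ((hL.mem_iff F).1 hF))
  have hsingle : IsShelling (skeleton (LowerSet.Iic V) k) [V] := by
    refine ⟨by simp, fun F => ?_, fun i hi hpos => ?_⟩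
    · rw [mem_facets_skeleton_Iic_of_card_le hk, List.mem_singleton]
    · simp only [List.length_singleton] at hi
      omega
  match L, hL.nodup, hLV with
  | [], _, _ => exact ⟨[V], hsingle⟩
  | [F], _, hLV =>
    obtain rfl := hLV F (by simp)
    exact ⟨[], hsingle⟩
  | F :: G :: L, hnd, hLV =>
    have hF := hLV F (by simp)
    have hG := hLV G (by simp)
    simp [hF, hG] at hnd

variable [DecidableEq α]

/-- Alexander duality: one step of a shelling is a link condition on the complements of the
facets. -/
theorem pure_inter_iff_linkedTo {V F : Finset α} {P : List (Finset α)} (hF : F ⊆ V) :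
    (∀ M ∈ facets (lowerClosure {G | G ∈ P} ⊓ LowerSet.Iic F), M.card + 1 = F.card) ↔
      LinkedTo {G | G ∈ P.map (V \ ·)} (V \ F) := by
  have hmem : ∀ M, M ∈ lowerClosure {G | G ∈ P} ⊓ LowerSet.Iic F ↔
      (∃ G ∈ P, M ⊆ G) ∧ M ⊆ F := by
    intro M
    simp [LowerSet.mem_inf_iff]
  constructor
  · intro h G' hG'
    obtain ⟨G, hG, rfl⟩ := List.mem_map.1 hG'
    have hfin : {M | M ∈ lowerClosure {G | G ∈ P} ⊓ LowerSet.Iic F}.Finite :=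
      F.powerset.finite_toSet.subset fun M hM => by
        simpa using ((hmem M).1 hM).2
    -- Purity makes a facet `M` containing `G ∩ F` miss just one vertex `v` of `F`; this `v` is the
    -- link, and the complement of an `H ⊇ M` is the witness.
    obtain ⟨M, hGM, hM⟩ := hfin.exists_le_maximal (a := G ∩ F)
      ((hmem _).2 ⟨⟨G, hG, Finset.inter_subset_left⟩, Finset.inter_subset_right⟩)
    obtain ⟨⟨H, hH, hMH⟩, hMF⟩ := (hmem M).1 hM.1
    have hcard := h M hM
    obtain ⟨v, hv⟩ : ∃ v, F \ M = {v} := by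
      rw [← Finset.card_eq_one, Finset.card_sdiff_of_subset hMF]; omega
    have hvF : v ∈ F \ M := by simp [hv]
    obtain ⟨hvF, hvM⟩ := Finset.mem_sdiff.1 hvF
    refine ⟨v, Finset.mem_sdiff.2 ⟨hF hvF, fun hvG => hvM (hGM ?_)⟩, by simp [hvF], V \ H,
      List.mem_map.2 ⟨H, hH, rfl⟩, fun x hx => ?_⟩
    · exact Finset.mem_inter.2 ⟨hvG, hvF⟩
    · obtain ⟨hxV, hxH⟩ := Finset.mem_sdiff.1 hx
      by_cases hxF : x ∈ F
      · have : x ∈ F \ M := Finset.mem_sdiff.2 ⟨hxF, fun h => hxH (hMH h)⟩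
        rw [hv, Finset.mem_singleton] at this
        exact Or.inl this
      · exact Or.inr (Finset.mem_sdiff.2 ⟨hxV, hxF⟩)
  · intro h M hM
    obtain ⟨⟨G, hG, hMG⟩, hMF⟩ := (hmem M).1 hM.1
    obtain ⟨v, hvG, hvF, H', hH', hsub⟩ := h _ (List.mem_map.2 ⟨G, hG, rfl⟩)
    obtain ⟨H, hH, rfl⟩ := List.mem_map.1 hH'
    obtain ⟨hvV, hvG⟩ := Finset.mem_sdiff.1 hvG
    have hvF : v ∈ F := by
      by_contra h'
      exact hvF (Finset.mem_sdiff.2 ⟨hvV, h'⟩)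
    have hMe : M ⊆ F.erase v := fun x hx =>
      Finset.mem_erase.2 ⟨fun hxv => hvG (hMG (hxv ▸ hx)), hMF hx⟩
    -- Dually, the witness says `F \ {v} ⊆ H`, so this face lies in the intersection; it contains
    -- the facet `M` and hence equals it.
    have hle : F.erase v ∈ lowerClosure {G | G ∈ P} ⊓ LowerSet.Iic F := by
      refine (hmem _).2 ⟨⟨H, hH, fun x hx => ?_⟩, Finset.erase_subset v F⟩
      obtain ⟨hxv, hxF⟩ := Finset.mem_erase.1 hx
      by_contra hxH
      rcases hsub x (Finset.mem_sdiff.2 ⟨hF hxF, hxH⟩) with h' | h'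
      · exact hxv h'
      · exact (Finset.mem_sdiff.1 h').2 hxF
    rw [hMe.antisymm (hM.2 hle hMe), Finset.card_erase_add_one hvF]

theorem isShelling_iff_linked {V : Finset α} {Δ : LowerSet (Finset α)} {L : List (Finset α)}
    (hV : ∀ F ∈ L, F ⊆ V) :
    IsShelling Δ L ↔ L.Nodup ∧ (∀ F, F ∈ L ↔ F ∈ facets Δ) ∧ Linked (L.map (V \ ·)) := by
  have key : ∀ (i : ℕ) (hi : i < L.length),
      (∀ F ∈ facets (lowerClosure {G | G ∈ L.take i} ⊓ LowerSet.Iic L[i]),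
        F.card + 1 = L[i].card) ↔ LinkedTo {G | G ∈ (L.take i).map (V \ ·)} (V \ L[i]) :=
    fun i hi => pure_inter_iff_linkedTo (hV _ (List.getElem_mem hi))
  constructor
  · rintro ⟨hnd, hmem, hpure⟩
    refine ⟨hnd, hmem, fun i hi => ?_⟩
    rw [List.length_map] at hi
    rw [List.getElem_map, ← List.map_take]
    rcases Nat.eq_zero_or_pos i with rfl | hpos
    · intro G hG
      simp at hG
    · exact (key i hi).1 (hpure i hi hpos)
  · rintro ⟨hnd, hmem, hL⟩
    refine ⟨hnd, hmem, fun i hi _ => (key i hi).2 ?_⟩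
    have := hL i (by simpa using hi)
    rwa [List.getElem_map, ← List.map_take] at this

/-- (B) implies Simon's conjecture. -/
theorem StatementB.simonConjecture {K : Type*} [Field K] (hB : StatementB α K) :
    SimonConjecture α := by
  intro V k
  rcases Nat.lt_or_ge (k + 1) V.card with hk | hk
  swap
  · exact extendablyShellable_skeleton_of_card_le hk
  intro Γ _ hΓ L hL
  -- Complements of `(k + 1)`-sets must have `d + 1 ≥ 1` elements; this is why `V.card ≤ k + 1` was
  -- treated apart.
  obtain ⟨d, hd⟩ : ∃ d, V.card = d + 1 + (k + 1) := ⟨V.card - (k + 1) - 1, by omega⟩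
  have hLV : ∀ F ∈ L, F ⊆ V ∧ F.card = k + 1 := fun F hF =>
    (mem_facets_skeleton_Iic hk.le).1 (hΓ ((hL.mem_iff F).1 hF))
  have hcompl : ∀ F ⊆ V, V \ (V \ F) = F := fun F hF => Finset.sdiff_sdiff_eq_self hF
  obtain ⟨hnd, -, hlink⟩ := (isShelling_iff_linked fun F hF => (hLV F hF).1).1 hL
  -- Chosen so that its non-circuits are exactly the complements of the facets shelled so far.
  let C : UniformClutter α d :=
    { verts := V
      circuits := V.powersetCard (d + 1) \ (L.map (V \ ·)).toFinset
      subset_verts := fun F hF => (Finset.mem_powersetCard.1 (Finset.mem_sdiff.1 hF).1).1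
      card_eq := fun F hF => (Finset.mem_powersetCard.1 (Finset.mem_sdiff.1 hF).1).2 }
  have hmem : ∀ F, F ∈ L.map (V \ ·) ↔ F ∈ C.compl.circuits := by
    intro F
    have h1 : F ∈ L.map (V \ ·) → F ⊆ V ∧ F.card = d + 1 := by
      intro hF
      obtain ⟨G, hG, rfl⟩ := List.mem_map.1 hF
      refine ⟨Finset.sdiff_subset, ?_⟩
      rw [Finset.card_sdiff_of_subset (hLV G hG).1, (hLV G hG).2]
      omega
    rw [UniformClutter.mem_compl_circuits]
    simp only [C, Finset.mem_sdiff, Finset.mem_powersetCard, List.mem_toFinset]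
    tauto
  have hnd' : (L.map (V \ ·)).Nodup := hnd.map_on fun F hF G hG h => by
    rw [← hcompl F (hLV F hF).1, ← hcompl G (hLV G hG).1, h]
  have hchordal : C.Chordal := hB d C
    ((C.compl.hasLinearQuotients_circuitIdeal).2 ⟨_, hnd', hmem, hlink⟩)
  obtain ⟨T, hTnd, hTmem, hTlink⟩ := hchordal.exists_linked_append hnd' hmem hlink
  have hTV : ∀ F ∈ T, F ⊆ V ∧ F.card = d + 1 := fun F hF =>
    Finset.mem_powersetCard.1 ((hTmem F).1 (List.mem_append_right _ hF))
  have hLmap : (L.map (V \ ·)).map (V \ ·) = L := by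
    rw [List.map_map]
    conv_rhs => rw [← List.map_id L]
    exact List.map_congr_left fun F hF => hcompl F (hLV F hF).1
  have hTmap : (T.map (V \ ·)).map (V \ ·) = T := by
    rw [List.map_map]
    conv_rhs => rw [← List.map_id T]
    exact List.map_congr_left fun F hF => hcompl F (hTV F hF).1
  have hsubV : ∀ F ∈ L ++ T.map (V \ ·), F ⊆ V := by
    intro F hF
    rcases List.mem_append.1 hF with hF | hF
    · exact (hLV F hF).1
    · obtain ⟨G, -, rfl⟩ := List.mem_map.1 hF
      exact Finset.sdiff_subset
  refine ⟨T.map (V \ ·), (isShelling_iff_linked hsubV).2 ⟨?_, fun F => ?_, ?_⟩⟩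
  · apply List.Nodup.of_map (V \ ·)
    rwa [List.map_append, hTmap]
  · have hiff : F ⊆ V → (F ∈ L ++ T.map (V \ ·) ↔ V \ F ∈ L.map (V \ ·) ++ T) := by
      intro hFV
      constructor
      · intro hF
        have := List.mem_map_of_mem (f := (V \ ·)) hF
        rwa [List.map_append, hTmap] at this
      · intro hF
        have := List.mem_map_of_mem (f := (V \ ·)) hF
        rwa [List.map_append, hLmap, hcompl F hFV] at this
    rw [mem_facets_skeleton_Iic hk.le]
    constructor
    · intro hF
      have hFV := hsubV F hF
      have hc := (Finset.mem_powersetCard.1 ((hTmem _).1 ((hiff hFV).1 hF))).2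
      rw [Finset.card_sdiff_of_subset hFV] at hc
      exact ⟨hFV, by omega⟩
    · rintro ⟨hFV, hFc⟩
      refine (hiff hFV).2 ((hTmem _).2 (Finset.mem_powersetCard.2 ⟨Finset.sdiff_subset, ?_⟩))
      rw [Finset.card_sdiff_of_subset hFV]
      omega
  · rwa [List.map_append, hTmap]

end Shelling

theorem mainTheorem5 (α : Type*) [DecidableEq α] (K : Type*) [Field K] :
    (StatementC α ∧ StatementD' α K → StatementB α K) ∧
      (StatementB α K → StatementD' α K ∧ SimonConjecture α) := by
  refine ⟨fun ⟨hC, hD⟩ d C h => ?_, fun hB => ⟨fun d C hne hasc h => ?_, hB.simonConjecture⟩⟩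
  · exact C.chordal_of_linkedFamily_compl hC hD ((C.compl.hasLinearQuotients_circuitIdeal).1 h)
  · obtain ⟨e, he⟩ := (hB d C h).SMS_nonempty hne
    exact ⟨e, UniformClutter.isFreeMS_of_mem_SMS hasc he⟩
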